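/- Let $K\ge 2$ and $T\ge 1$. In the $K$-armed adversarial bandit problem over $T$ rounds, a (randomised) strategy chooses in each round $t$, as a (measurable) function of the history $(I_s,\ell_{I_s,s})_{s<t}$ of its own past actions and the losses it observed, a probability vector $p_t$ over $\{1,\dots,K\}$, and samples its action $I_t$ from $p_t$. On a loss sequence $\ell_{1:T}\in[0,1]^{KT}$, fixed in advance, its regret is \[ R_T(\ell_{1:T})=\sum_{t=1}^T \ell_{I_t,t}-\min_{1\le i\le K}\sum_{t=1}^T \ell_{i,t}. \] Suppose a strategy and a constant $C>0$ are such that $\mathbb{E}[R_T(\ell_{1:T})]\le C\sqrt{(K-1)T}$ for every $\ell_{1:T}\in[0,1]^{KT}$. Let $\delta\in(0,1/4)$ satisfy \[ \sqrt{\frac{K-1}{T}}\,\log\frac{1}{4\delta}\le C \qquad\text{and}\qquad T\ge 32\log\frac{2}{\delta}. \] Then there exists $\ell_{1:T}\in[0,1]^{KT}$ for which \[ \mathbb{P}\left(R_T(\ell_{1:T})\ge \frac{\sqrt{(K-1)T}\,\log(1/(4\delta))}{203\,C}\right)\ge \frac{\delta}{2}. \] Expectation and probability are taken with respect to the randomness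 of the strategy. -/

import Mathlib

open MeasureTheory

namespace Bandit

/-- A loss sequence `ℓ_{1:T} ∈ [0,1]^{KT}`; `ℓ t i` is the loss of action `i` in round `t`. -/
abbrev Losses (K T : ℕ) : Type := Fin T → Fin K → unitInterval

/-- A (randomised) strategy for the `K`-armed bandit over `T` rounds. In round `t` (rounds are
numbered from `0`) it maps the list of the actions played and the losses observed in the `t`
earlier rounds, measurably, to a probability vector over the `K` actions. -/
structure Strategy (K T : ℕ) where
  weights : (t : Fin T) → (Fin t → Fin K × unitInterval) → Fin K → ℝ
  weights_mem : ∀ t h, weights t h ∈ stdSimplex ℝ (Fin K)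
  measurable_weights : ∀ t, Measurable (weights t)

/-- The history before round `t`: the earlier actions, each with the loss of that action only. -/
def history {K T : ℕ} (ℓ : Losses K T) (a : Fin T → Fin K) (t : Fin T) :
    Fin t → Fin K × unitInterval :=
  fun s => (a (s.castLE t.isLt.le), ℓ (s.castLE t.isLt.le) (a (s.castLE t.isLt.le)))

/-- The regret of the action sequence `a` on the loss sequence `ℓ`. -/
noncomputable def regret {K T : ℕ} (ℓ : Losses K T) (a : Fin T → Fin K) : ℝ :=
  ∑ t, (ℓ t (a t) : ℝ) - ⨅ i, ∑ t, (ℓ t i : ℝ)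

namespace Strategy

variable {K T : ℕ}

/-- The probability that the strategy plays the action sequence `a` on the loss sequence `ℓ`,
when the action of each round is sampled from the probability vector of that round. -/
def actionProb (π : Strategy K T) (ℓ : Losses K T) (a : Fin T → Fin K) : ℝ :=
  ∏ t, π.weights t (history ℓ a t) (a t)

/-- The law of the sequence of actions played by the strategy on the loss sequence `ℓ`. -/
noncomputable def actionLaw (π : Strategy K T) (ℓ : Losses K T) : Measure (Fin T → Fin K) :=
  ∑ a, ENNReal.ofReal (π.actionProb ℓ a) • Measure.dirac a

theorem actionProb_nonneg (π : Strategy K T) (ℓ : Losses K T) (a : Fin T → Fin K) :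
    0 ≤ π.actionProb ℓ a :=
  Finset.prod_nonneg fun t _ => (π.weights_mem t _).1 _

theorem sum_prod_eq_one {K : ℕ} : ∀ (T : ℕ) (q : (t : Fin T) → (Fin t → Fin K) → Fin K → ℝ),
    (∀ t h, ∑ i, q t h i = 1) →
    ∑ a : Fin T → Fin K, ∏ t, q t (fun s => a (s.castLE t.isLt.le)) (a t) = 1
  | 0, _, _ => by simp
  | T + 1, q, hq => by
    rw [← (Fin.snocEquiv fun _ : Fin (T + 1) => Fin K).sum_comp, Fintype.sum_prod_type_right]
    have ih := sum_prod_eq_one T (fun t => q t.castSucc) fun t h => hq _ _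
    rw [← ih]
    refine Finset.sum_congr rfl fun a _ => ?_
    have h1 : ∀ (t : Fin T) (x : Fin K) (s : Fin t.castSucc),
        (Fin.snoc a x : Fin (T + 1) → Fin K) (s.castLE t.castSucc.isLt.le)
          = a (Fin.castLE (n := t) t.isLt.le s) := fun t x s =>
      Fin.snoc_castSucc (α := fun _ => Fin K) x a (Fin.castLE (n := t) t.isLt.le s)
    have h2 : ∀ (x : Fin K) (s : Fin (Fin.last T)),
        (Fin.snoc a x : Fin (T + 1) → Fin K) (s.castLE (Fin.last T).isLt.le) = a s := fun x s =>
      Fin.snoc_castSucc (α := fun _ => Fin K) x a s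
    simp only [Fin.snocEquiv, Equiv.coe_fn_mk, Fin.prod_univ_castSucc, h1, h2, Fin.snoc_castSucc,
      Fin.snoc_last]
    rw [← Finset.mul_sum, hq, mul_one]
    rfl

instance (π : Strategy K T) (ℓ : Losses K T) : IsProbabilityMeasure (π.actionLaw ℓ) where
  measure_univ := by
    have h := sum_prod_eq_one T
      (fun t h => π.weights t fun s => (h s, ℓ (s.castLE t.isLt.le) (h s)))
      fun t h => (π.weights_mem t _).2
    have h' : ∑ a, π.actionProb ℓ a = 1 := h
    simp [actionLaw, ← ENNReal.ofReal_sum_of_nonneg fun a _ => π.actionProb_nonneg ℓ a, h']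

end Strategy

end Bandit

/-!
Let the losses of all the arms in a round be one common noise on a grid of mesh `1 / m`, shifted
down by `0`, `1` or `2` steps and clipped to `[0, 1]`. The mean losses for different shifts differ
by an amount of order `1 / m`, but the laws of the losses differ only in the atoms at the two ends,
so that a single observation carries relative entropy of order `1 / m ^ 2` only.

Let one arm be shifted by `1` and the others by `0`. As the expected regret is at most
`C * √((K - 1) * T)`, some other arm is played rarely, and if it is shifted by `2` instead, the
strategy hardly notices: by the divergence decomposition and the Bretagnolle–Huber inequality, in
one of the two environments it plays the best arm at most `T / 2` times with probability at least
`δ`. By Hoeffding's inequality for the noise this costs `T / m` up to a constant, outside an event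
of probability at most `δ / 2`, and some realisation of the noise is a loss sequence as required.

With `L = log (1 / (4 * δ))` one may take `m` about `35 * C * √(T / (K - 1)) / L`, and then `T / m`
is of order `√((K - 1) * T) * L / C`.
-/

namespace Bandit

open Finset

section FiniteLaws

open Real

variable {X : Type*} [Fintype X] {p q : X → ℝ}

theorem exists_le_of_le_sum_mul (hp : p ∈ stdSimplex ℝ X) {F : X → ℝ} {c : ℝ}
    (h : c ≤ ∑ x, p x * F x) : ∃ x, c ≤ F x := by
  by_contra! hF
  exact h.not_gt ((convex_Iio c).sum_mem (fun x _ => hp.1 x) hp.2 fun x _ => hF x)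

/-- The relative entropy (Kullback–Leibler divergence) of two laws on a finite set, given by their
weights. It has its usual meaning only where `q x = 0` implies `p x = 0`. -/
noncomputable def relEntropy (p q : X → ℝ) : ℝ :=
  ∑ x, p x * log (p x / q x)

theorem relEntropy_self (p : X → ℝ) : relEntropy p p = 0 :=
  sum_eq_zero fun x _ => by rcases eq_or_ne (p x) 0 with h | h <;> simp [h]

theorem exp_neg_half_relEntropy_le_sum_sqrt (hp : p ∈ stdSimplex ℝ X) (hq : ∀ x, 0 ≤ q x)
    (hpq : ∀ x, q x = 0 → p x = 0) : exp (-relEntropy p q / 2) ≤ ∑ x, √(p x * q x) := by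
  have hterm (x : X) : p x * exp (-log (p x / q x) / 2) ≤ √(p x * q x) := by
    rcases (hp.1 x).eq_or_lt with h | h
    · simp [← h]
    have hqx : 0 < q x := (hq x).lt_of_ne' fun h0 => h.ne' (hpq x h0)
    rw [exp_half, exp_neg, exp_log (div_pos h hqx), inv_div]
    refine le_of_eq ?_
    calc p x * √(q x / p x) = √(p x ^ 2 * (q x / p x)) := by
          rw [sqrt_mul (sq_nonneg _), sqrt_sq h.le]
      _ = √(p x * q x) := by congr 1; field_simp
  calc exp (-relEntropy p q / 2)
      = exp (∑ x, p x • (-log (p x / q x) / 2)) := by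
        simp only [relEntropy, smul_eq_mul, neg_div, mul_neg, sum_neg_distrib, sum_div,
          mul_div_assoc]
    _ ≤ ∑ x, p x • exp (-log (p x / q x) / 2) :=
        convexOn_exp.map_sum_le (fun x _ => hp.1 x) hp.2 fun _ _ => Set.mem_univ _
    _ ≤ ∑ x, √(p x * q x) := sum_le_sum fun x _ => hterm x

theorem sq_sum_sqrt_mul_le (hp : p ∈ stdSimplex ℝ X) (hq : q ∈ stdSimplex ℝ X) :
    (∑ x, √(p x * q x)) ^ 2 ≤ 2 * ∑ x, min (p x) (q x) := by
  have hmax : ∑ x, max (p x) (q x) ≤ 2 := by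
    calc ∑ x, max (p x) (q x) ≤ ∑ x, (p x + q x) :=
          sum_le_sum fun x _ => max_le_add_of_nonneg (hp.1 x) (hq.1 x)
      _ = 2 := by rw [sum_add_distrib, hp.2, hq.2]; norm_num
  have hmin : 0 ≤ ∑ x, min (p x) (q x) := sum_nonneg fun x _ => le_min (hp.1 x) (hq.1 x)
  calc (∑ x, √(p x * q x)) ^ 2
      ≤ (∑ x, max (p x) (q x)) * ∑ x, min (p x) (q x) :=
        sum_sq_le_sum_mul_sum_of_sq_le_mul univ
          (fun x _ => (hp.1 x).trans (le_max_left _ _)) (fun x _ => le_min (hp.1 x) (hq.1 x))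
          fun x _ => by rw [sq_sqrt (mul_nonneg (hp.1 x) (hq.1 x)), max_mul_min]
    _ ≤ 2 * ∑ x, min (p x) (q x) := by gcongr

theorem bretagnolle_huber (hp : p ∈ stdSimplex ℝ X) (hq : q ∈ stdSimplex ℝ X)
    (hpq : ∀ x, q x = 0 → p x = 0) (A : X → Prop) [DecidablePred A] :
    exp (-relEntropy p q) / 2 ≤ ∑ x with A x, p x + ∑ x with ¬A x, q x := by
  have hsq : exp (-relEntropy p q) ≤ 2 * ∑ x, min (p x) (q x) := by
    calc exp (-relEntropy p q) = exp (-relEntropy p q / 2) ^ 2 := by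
          rw [← exp_nat_mul]; congr 1; push_cast; ring
      _ ≤ (∑ x, √(p x * q x)) ^ 2 := by
          gcongr; exact exp_neg_half_relEntropy_le_sum_sqrt hp hq.1 hpq
      _ ≤ 2 * ∑ x, min (p x) (q x) := sq_sum_sqrt_mul_le hp hq
  have hmin : ∑ x, min (p x) (q x) ≤ ∑ x with A x, p x + ∑ x with ¬A x, q x := by
    rw [← sum_filter_add_sum_filter_not univ A]
    gcongr
    exacts [min_le_left _ _, min_le_right _ _]
  linarith

end FiniteLaws

section DiscreteLaw

variable {X : Type*} [Fintype X] [MeasurableSpace X] {p : X → ℝ}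

/-- The measure on a finite space with prescribed weights; `Strategy.actionLaw` is of this form. -/
noncomputable def discreteLaw (p : X → ℝ) : Measure X :=
  ∑ x, ENNReal.ofReal (p x) • Measure.dirac x

theorem isProbabilityMeasure_discreteLaw (hp : p ∈ stdSimplex ℝ X) :
    IsProbabilityMeasure (discreteLaw p) where
  measure_univ := by
    simp [discreteLaw, ← ENNReal.ofReal_sum_of_nonneg fun x _ => hp.1 x, hp.2]

variable [MeasurableSingletonClass X]

theorem discreteLaw_singleton (p : X → ℝ) (x : X) : discreteLaw p {x} = ENNReal.ofReal (p x) := by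
  classical
  simp [discreteLaw, Measure.finsetSum_apply, Set.indicator_apply]

theorem real_discreteLaw (hp : p ∈ stdSimplex ℝ X) (A : X → Prop) [DecidablePred A] :
    (discreteLaw p).real {x | A x} = ∑ x with A x, p x := by
  have := isProbabilityMeasure_discreteLaw hp
  rw [← coe_filter_univ, ← sum_measureReal_singleton]
  refine sum_congr rfl fun x _ => ?_
  rw [measureReal_def, discreteLaw_singleton, ENNReal.toReal_ofReal (hp.1 x)]

theorem integral_discreteLaw (hp : p ∈ stdSimplex ℝ X) (f : X → ℝ) :
    ∫ x, f x ∂(discreteLaw p) = ∑ x, p x * f x := by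
  have := isProbabilityMeasure_discreteLaw hp
  rw [integral_fintype Integrable.of_finite]
  refine sum_congr rfl fun x _ => ?_
  rw [measureReal_def, discreteLaw_singleton, ENNReal.toReal_ofReal (hp.1 x), smul_eq_mul]

theorem pi_discreteLaw {ι : Type*} [Fintype ι] [DecidableEq ι] (hp : p ∈ stdSimplex ℝ X) :
    Measure.pi (fun _ : ι => discreteLaw p) = discreteLaw fun z : ι → X => ∏ t, p (z t) := by
  have := isProbabilityMeasure_discreteLaw hp
  refine Measure.ext_of_singleton fun z => ?_
  simp only [Measure.pi_singleton, discreteLaw_singleton]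
  rw [ENNReal.ofReal_prod_of_nonneg fun t _ => hp.1 _]

end DiscreteLaw

theorem prod_mem_stdSimplex {ι X : Type*} [Fintype ι] [DecidableEq ι] [Fintype X] {p : X → ℝ}
    (hp : p ∈ stdSimplex ℝ X) : (fun z : ι → X => ∏ t, p (z t)) ∈ stdSimplex ℝ (ι → X) :=
  ⟨fun _ => prod_nonneg fun _ _ => hp.1 _, by
    rw [← Fintype.prod_sum fun (_ : ι) x => p x]; simp [hp.2]⟩

theorem hoeffding_sum_le {ι X : Type*} [Fintype ι] [DecidableEq ι] [Fintype X]
    {p : X → ℝ} (hp : p ∈ stdSimplex ℝ X) {g : X → ℝ} {c ε : ℝ} (hc : 0 < c)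
    (hg : ∀ x, g x ∈ Set.Icc 0 c) (hε : 0 ≤ ε) :
    ∑ z : ι → X with ∑ t, g (z t) ≤ (∑ x, p x * g x - c * ε) * Fintype.card ι, ∏ t, p (z t)
      ≤ Real.exp (-(2 * ε ^ 2 * Fintype.card ι)) := by
  let _ : MeasurableSpace X := ⊤
  have := isProbabilityMeasure_discreteLaw hp
  set μ := ∑ x, p x * g x
  have hmean : ∫ x, -g x ∂(discreteLaw p) = -μ := by
    rw [integral_neg, integral_discreteLaw hp]
  have hsub (t : ι) : ProbabilityTheory.HasSubgaussianMGF (fun z : ι → X => μ - g (z t))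
      ((‖c‖₊ / 2) ^ 2) (Measure.pi fun _ => discreteLaw p) := by
    have h := ProbabilityTheory.hasSubgaussianMGF_of_mem_Icc (μ := discreteLaw p)
      (X := fun x => -g x) (a := -c) (b := 0) (by fun_prop)
      (.of_forall fun x => ⟨neg_le_neg (hg x).2, neg_nonpos.2 (hg x).1⟩)
    have heval := measurePreserving_eval (fun _ : ι => discreteLaw p) t
    rw [hmean, ← heval.map_eq] at h
    simpa [Function.comp_def, neg_add_eq_sub] using h.of_map heval.measurable.aemeasurable
  have htail := ProbabilityTheory.HasSubgaussianMGF.measure_sum_ge_le_of_iIndepFun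
    (ProbabilityTheory.iIndepFun_pi (X := fun (_ : ι) x => μ - g x) fun _ => by fun_prop)
    (s := univ) (fun t _ => hsub t) (ε := c * ε * Fintype.card ι) (by positivity)
  rw [pi_discreteLaw hp, real_discreteLaw (prod_mem_stdSimplex hp)] at htail
  have hexp : -(c * ε * Fintype.card ι) ^ 2 / (2 * ∑ _t : ι, (((‖c‖₊ / 2) ^ 2 : NNReal) : ℝ))
      = -(2 * ε ^ 2 * Fintype.card ι) := by
    rcases Nat.eq_zero_or_pos (Fintype.card ι) with h0 | hpos
    · simp [h0]
    · simp only [NNReal.coe_pow, NNReal.coe_div, coe_nnnorm, Real.norm_of_nonneg hc.le,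
        NNReal.coe_ofNat, sum_const, card_univ, nsmul_eq_mul]
      field_simp
  rw [← hexp, ← NNReal.coe_sum]
  convert htail using 3 with z
  rw [sum_sub_distrib, sum_const, card_univ, nsmul_eq_mul]
  constructor <;> intro h <;> linarith

section SequentialLaws

variable {Y Y' : Type*} {T : ℕ}

/-- The entries of a sequence before round `t`. -/
def past (y : Fin T → Y) (t : Fin T) : Fin t → Y :=
  fun s => y (s.castLE t.isLt.le)

/-- The law of a random sequence whose entry in round `t` is drawn from the weights `q t h`, where
`h` is the list of the earlier entries. -/
def seqProb (q : (t : Fin T) → (Fin t → Y) → Y → ℝ) (y : Fin T → Y) : ℝ :=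
  ∏ t, q t (past y t) (y t)

theorem past_snoc_castSucc (a : Fin T → Y) (x : Y) (t : Fin T) :
    past (Fin.snoc a x : Fin (T + 1) → Y) t.castSucc = past a t :=
  funext fun s => Fin.snoc_castSucc (α := fun _ => Y) x a (Fin.castLE (n := t) t.isLt.le s)

theorem past_snoc_last (a : Fin T → Y) (x : Y) :
    past (Fin.snoc a x : Fin (T + 1) → Y) (Fin.last T) = a :=
  funext fun s => Fin.snoc_castSucc (α := fun _ => Y) x a s

theorem seqProb_eq_zero {q q' : (t : Fin T) → (Fin t → Y) → Y → ℝ}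
    (hqq' : ∀ t h x, q' t h x = 0 → q t h x = 0) {y : Fin T → Y} (hy : seqProb q' y = 0) :
    seqProb q y = 0 := by
  obtain ⟨t, ht, h⟩ := prod_eq_zero_iff.1 hy
  exact prod_eq_zero ht (hqq' _ _ _ h)

variable [Fintype Y] [Fintype Y']

theorem sum_seqProb_succ (q : (t : Fin (T + 1)) → (Fin t → Y) → Y → ℝ)
    (F : (Fin (T + 1) → Y) → ℝ) :
    ∑ y, seqProb q y * F y = ∑ a, seqProb (fun t => q t.castSucc) a *
      ∑ x, q (Fin.last T) a x * F (Fin.snoc a x) := by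
  rw [← (Fin.snocEquiv fun _ : Fin (T + 1) => Y).sum_comp, Fintype.sum_prod_type_right]
  refine sum_congr rfl fun a _ => ?_
  simp only [mul_sum, ← mul_assoc]
  refine sum_congr rfl fun x _ => ?_
  simp only [Fin.snocEquiv, Equiv.coe_fn_mk, seqProb, Fin.prod_univ_castSucc, Fin.snoc_last,
    Fin.snoc_castSucc, past_snoc_last, past_snoc_castSucc]

theorem sum_seqProb_eq_one : ∀ {T : ℕ} {q : (t : Fin T) → (Fin t → Y) → Y → ℝ},
    (∀ t h, q t h ∈ stdSimplex ℝ Y) → ∑ y, seqProb q y = 1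
  | 0, _, _ => by simp [seqProb]
  | T + 1, q, hq => by
    have h := sum_seqProb_succ q fun _ => 1
    simp only [mul_one, (hq _ _).2] at h
    rw [h, sum_seqProb_eq_one fun t => hq t.castSucc]

theorem seqProb_mem_stdSimplex {q : (t : Fin T) → (Fin t → Y) → Y → ℝ}
    (hq : ∀ t h, q t h ∈ stdSimplex ℝ Y) : seqProb q ∈ stdSimplex ℝ (Fin T → Y) :=
  ⟨fun _ => prod_nonneg fun _ _ => (hq _ _).1 _, sum_seqProb_eq_one hq⟩

theorem sum_seqProb_mul_past : ∀ {T : ℕ} {q : (t : Fin T) → (Fin t → Y) → Y → ℝ},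
    (∀ t h, q t h ∈ stdSimplex ℝ Y) → ∀ (t : Fin T) (F : (Fin t → Y) → Y → ℝ),
    ∑ y, seqProb q y * F (past y t) (y t)
      = ∑ y, seqProb q y * ∑ x, q t (past y t) x * F (past y t) x
  | 0, _, _, t, _ => t.elim0
  | T + 1, q, hq, t, F => by
    rw [sum_seqProb_succ q fun y => F (past y t) (y t),
      sum_seqProb_succ q fun y => ∑ x, q t (past y t) x * F (past y t) x]
    cases t using Fin.lastCases with
    | last => simp only [past_snoc_last, Fin.snoc_last, ← sum_mul, (hq _ _).2, one_mul]
    | cast t =>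
      simp only [past_snoc_castSucc, Fin.snoc_castSucc, ← sum_mul, (hq _ _).2, one_mul]
      exact sum_seqProb_mul_past (fun t => hq t.castSucc) t F

theorem sum_seqProb_comp (φ : Y → Y') : ∀ {T : ℕ} {q : (t : Fin T) → (Fin t → Y) → Y → ℝ}
    {q' : (t : Fin T) → (Fin t → Y') → Y' → ℝ},
    (∀ t h (G : Y' → ℝ), ∑ y, q t h y * G (φ y) = ∑ y', q' t (φ ∘ h) y' * G y') →
    ∀ F : (Fin T → Y') → ℝ, ∑ y, seqProb q y * F (φ ∘ y) = ∑ y', seqProb q' y' * F y'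
  | 0, _, _, _, F => by simp [seqProb, Subsingleton.elim (φ ∘ _) (default : Fin 0 → Y')]
  | T + 1, q, q', h, F => by
    rw [sum_seqProb_succ q fun y => F (φ ∘ y), sum_seqProb_succ q' F,
      ← sum_seqProb_comp φ fun t => h t.castSucc]
    refine sum_congr rfl fun a _ => ?_
    simp only [Fin.comp_snoc]
    rw [h (Fin.last T) a fun y' => F (Fin.snoc (φ ∘ a) y')]

theorem relEntropy_seqProb {q q' : (t : Fin T) → (Fin t → Y) → Y → ℝ}
    (hq : ∀ t h, q t h ∈ stdSimplex ℝ Y) (hqq' : ∀ t h x, q' t h x = 0 → q t h x = 0) :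
    relEntropy (seqProb q) (seqProb q')
      = ∑ y, seqProb q y * ∑ t, relEntropy (q t (past y t)) (q' t (past y t)) := by
  have hlog (y : Fin T → Y) : seqProb q y * Real.log (seqProb q y / seqProb q' y)
      = ∑ t, seqProb q y * Real.log (q t (past y t) (y t) / q' t (past y t) (y t)) := by
    rcases eq_or_ne (seqProb q y) 0 with h0 | h0
    · simp [h0]
    have hne (t : Fin T) : q t (past y t) (y t) ≠ 0 := prod_ne_zero_iff.1 h0 t (mem_univ t)
    rw [← mul_sum, seqProb, seqProb, ← prod_div_distrib,
      Real.log_prod fun t _ => div_ne_zero (hne t) fun h => hne t (hqq' _ _ _ h)]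
  simp only [relEntropy, hlog, mul_sum (s := (univ : Finset (Fin T)))]
  rw [sum_comm, sum_comm (s := (univ : Finset (Fin T → Y)))]
  exact sum_congr rfl fun t _ =>
    sum_seqProb_mul_past hq t fun h x => Real.log (q t h x / q' t h x)

end SequentialLaws

section Play

variable {K T : ℕ} {X Z : Type*}

namespace Strategy

/-- One round of play against random losses: the strategy draws an action, and then a signal `x` is
drawn from the law `p i` attached to the action `i` drawn. The loss observed is `v i x`. -/
def playStep (π : Strategy K T) (v : Fin K → X → unitInterval) (p : Fin K → X → ℝ) (t : Fin T)
    (h : Fin t → Fin K × X) (y : Fin K × X) : ℝ :=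
  π.weights t (fun s => ((h s).1, v (h s).1 (h s).2)) y.1 * p y.1 y.2

/-- The law of the sequence of actions and signals when the strategy plays against random losses
(see `playStep`). -/
def playProb (π : Strategy K T) (v : Fin K → X → unitInterval) (p : Fin K → X → ℝ) :
    (Fin T → Fin K × X) → ℝ :=
  seqProb (π.playStep v p)

theorem playStep_eq_zero (π : Strategy K T) {v : Fin K → X → unitInterval} {p p' : Fin K → X → ℝ}
    (hpp' : ∀ i x, p' i x = 0 → p i x = 0) {t : Fin T} {h : Fin t → Fin K × X} {y : Fin K × X}
    (hy : π.playStep v p' t h y = 0) : π.playStep v p t h y = 0 :=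
  (mul_eq_zero.1 hy).elim (mul_eq_zero_of_left · _) fun h0 =>
    mul_eq_zero_of_right _ (hpp' _ _ h0)

theorem playProb_eq_zero (π : Strategy K T) {v : Fin K → X → unitInterval} {p p' : Fin K → X → ℝ}
    (hpp' : ∀ i x, p' i x = 0 → p i x = 0) {y : Fin T → Fin K × X} (hy : π.playProb v p' y = 0) :
    π.playProb v p y = 0 :=
  seqProb_eq_zero (fun _ _ _ => π.playStep_eq_zero hpp') hy

variable [Fintype X] [Fintype Z]

theorem playStep_mem_stdSimplex (π : Strategy K T) (v : Fin K → X → unitInterval)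
    {p : Fin K → X → ℝ} (hp : ∀ i, p i ∈ stdSimplex ℝ X) (t : Fin T) (h : Fin t → Fin K × X) :
    π.playStep v p t h ∈ stdSimplex ℝ (Fin K × X) :=
  ⟨fun _ => mul_nonneg ((π.weights_mem _ _).1 _) ((hp _).1 _), by
    simp only [playStep, Fintype.sum_prod_type, ← mul_sum, (hp _).2, mul_one,
      (π.weights_mem _ _).2]⟩

theorem playProb_mem_stdSimplex (π : Strategy K T) (v : Fin K → X → unitInterval)
    {p : Fin K → X → ℝ} (hp : ∀ i, p i ∈ stdSimplex ℝ X) :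
    π.playProb v p ∈ stdSimplex ℝ (Fin T → Fin K × X) :=
  seqProb_mem_stdSimplex (π.playStep_mem_stdSimplex v hp)

theorem sum_playProb_mul_signal (π : Strategy K T) (v : Fin K → X → unitInterval)
    {p : Fin K → X → ℝ} (hp : ∀ i, p i ∈ stdSimplex ℝ X) (t : Fin T) (F : Fin K → X → ℝ) :
    ∑ y, π.playProb v p y * F (y t).1 (y t).2
      = ∑ y, π.playProb v p y * ∑ x, p (y t).1 x * F (y t).1 x := by
  rw [playProb, sum_seqProb_mul_past (π.playStep_mem_stdSimplex v hp) t fun _ y => F y.1 y.2,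
    sum_seqProb_mul_past (π.playStep_mem_stdSimplex v hp) t fun _ y => ∑ x, p y.1 x * F y.1 x]
  simp only [playStep, Fintype.sum_prod_type, mul_assoc, ← mul_sum, ← sum_mul, (hp _).2, one_mul]

theorem relEntropy_playStep (π : Strategy K T) (v : Fin K → X → unitInterval)
    (p p' : Fin K → X → ℝ) (t : Fin T) (h : Fin t → Fin K × X) :
    relEntropy (π.playStep v p t h) (π.playStep v p' t h)
      = ∑ y, π.playStep v p t h y * Real.log (p y.1 y.2 / p' y.1 y.2) := by
  refine sum_congr rfl fun y _ => ?_
  rcases eq_or_ne (π.weights t (fun s => ((h s).1, v (h s).1 (h s).2)) y.1) 0 with h0 | h0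
  · simp [playStep, h0]
  · simp only [playStep, mul_div_mul_left _ _ h0]

theorem relEntropy_playProb (π : Strategy K T) (v : Fin K → X → unitInterval)
    {p p' : Fin K → X → ℝ} (hp : ∀ i, p i ∈ stdSimplex ℝ X) (hpp' : ∀ i x, p' i x = 0 → p i x = 0) :
    relEntropy (π.playProb v p) (π.playProb v p')
      = ∑ y, π.playProb v p y * ∑ t, relEntropy (p (y t).1) (p' (y t).1) := by
  rw [playProb, playProb, relEntropy_seqProb (π.playStep_mem_stdSimplex v hp)
    fun _ _ _ => π.playStep_eq_zero hpp']
  simp only [relEntropy_playStep, mul_sum]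
  rw [sum_comm, sum_comm (s := (univ : Finset (Fin T → Fin K × X)))]
  refine sum_congr rfl fun t _ => ?_
  simp only [← mul_sum]
  rw [← sum_seqProb_mul_past (π.playStep_mem_stdSimplex v hp) t fun _ y =>
    Real.log (p y.1 y.2 / p' y.1 y.2)]
  exact π.sum_playProb_mul_signal v hp t fun i x => Real.log (p i x / p' i x)

theorem sum_playProb_map_signal (π : Strategy K T) (v : Fin K → X → unitInterval)
    {f : Fin K → Z → X} {p : Fin K → Z → ℝ} {p' : Fin K → X → ℝ}
    (hf : ∀ i (G : X → ℝ), ∑ z, p i z * G (f i z) = ∑ x, p' i x * G x)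
    (F : (Fin T → Fin K) → ℝ) :
    ∑ y, π.playProb (fun i z => v i (f i z)) p y * F (fun t => (y t).1)
      = ∑ y, π.playProb v p' y * F (fun t => (y t).1) := by
  refine sum_seqProb_comp (fun y : Fin K × Z => (y.1, f y.1 y.2)) (fun _ _ G => ?_)
    fun y => F fun t => (y t).1
  simp only [playStep, Fintype.sum_prod_type, mul_assoc, ← mul_sum]
  exact sum_congr rfl fun i _ => congrArg _ (hf i fun x => G (i, x))

theorem actionProb_mem_stdSimplex (π : Strategy K T) (ℓ : Losses K T) :
    π.actionProb ℓ ∈ stdSimplex ℝ (Fin T → Fin K) :=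
  ⟨π.actionProb_nonneg ℓ, sum_prod_eq_one T
    (fun t h => π.weights t fun s => (h s, ℓ (s.castLE t.isLt.le) (h s)))
    fun t _ => (π.weights_mem t _).2⟩

/-- As the law of the signals does not depend on the actions, they may be drawn before the
play. -/
theorem sum_playProb_const (π : Strategy K T) (v : Fin K → X → unitInterval) (ω : X → ℝ)
    (F : (Fin T → Fin K) → (Fin T → X) → ℝ) :
    ∑ y, π.playProb v (fun _ => ω) y * F (fun t => (y t).1) (fun t => (y t).2)
      = ∑ z : Fin T → X, (∏ t, ω (z t)) *
          ∑ a, π.actionProb (fun t i => v i (z t)) a * F a z := by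
  rw [← (Equiv.arrowProdEquivProdArrow (Fin T) (fun _ => Fin K) fun _ => X).symm.sum_comp,
    Fintype.sum_prod_type_right]
  refine sum_congr rfl fun z _ => ?_
  rw [mul_sum]
  refine sum_congr rfl fun a _ => ?_
  rw [← mul_assoc, mul_comm (∏ t, ω (z t)), actionProb, ← prod_mul_distrib]
  rfl

end Strategy

end Play

section Regret

variable {K T : ℕ}

/-- The number of rounds in which the action `i` is played. -/
def pulls (i : Fin K) (a : Fin T → Fin K) : ℕ :=
  #{t | a t = i}

theorem sum_pulls (a : Fin T → Fin K) : ∑ i, pulls i a = T := by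
  simpa [pulls] using (card_eq_sum_card_fiberwise (f := a) (s := univ) (t := univ) (by simp)).symm

theorem pulls_add_pulls_le {i b : Fin K} (h : i ≠ b) (a : Fin T → Fin K) :
    pulls i a + pulls b a ≤ T := by
  simpa [sum_pair h, sum_pulls] using
    sum_le_sum_of_subset (f := fun j => pulls j a) (subset_univ {i, b})

theorem cast_pulls (i : Fin K) (a : Fin T → Fin K) :
    (pulls i a : ℝ) = ∑ t, if a t = i then 1 else 0 := by
  simp [pulls]

theorem sum_sub_le_regret (ℓ : Losses K T) (a : Fin T → Fin K) (b : Fin K) :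
    ∑ t, ((ℓ t (a t) : ℝ) - ℓ t b) ≤ regret ℓ a := by
  rw [sum_sub_distrib, regret]
  gcongr
  exact ciInf_le (Set.finite_range _).bddBelow b

theorem sum_sub_mul_pulls_le_regret {ℓ : Losses K T} {b : Fin K} {g : Fin T → ℝ} {c : ℝ}
    (hg : ∀ t, ∀ i ≠ b, g t ≤ ℓ t i - ℓ t b) (hc : ∀ t, g t ≤ c) (a : Fin T → Fin K) :
    ∑ t, g t - c * pulls b a ≤ regret ℓ a := by
  refine le_trans ?_ (sum_sub_le_regret ℓ a b)
  rw [cast_pulls, mul_sum, ← sum_sub_distrib]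
  refine sum_le_sum fun t _ => ?_
  split_ifs with h
  · simpa [h] using hc t
  · simpa using hg t _ h

namespace Strategy

variable {Z : Type*} [Fintype Z] (π : Strategy K T) {v : Fin K → Z → unitInterval} {ω : Z → ℝ}
  {i b : Fin K}

theorem integral_actionLaw (ℓ : Losses K T) (f : (Fin T → Fin K) → ℝ) :
    ∫ a, f a ∂(π.actionLaw ℓ) = ∑ a, π.actionProb ℓ a * f a :=
  integral_discreteLaw (π.actionProb_mem_stdSimplex ℓ) f

theorem real_actionLaw (ℓ : Losses K T) (A : (Fin T → Fin K) → Prop) [DecidablePred A] :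
    (π.actionLaw ℓ).real {a | A a} = ∑ a, π.actionProb ℓ a * if A a then 1 else 0 := by
  simp only [mul_ite, mul_one, mul_zero, ← sum_filter]
  exact real_discreteLaw (π.actionProb_mem_stdSimplex ℓ) A

theorem mul_sum_playProb_le (hω : ω ∈ stdSimplex ℝ Z) {γ R : ℝ}
    (hγ : ∀ i ≠ b, γ ≤ ∑ z, ω z * (v i z - v b z))
    (hR : ∀ ℓ, ∫ a, regret ℓ a ∂(π.actionLaw ℓ) ≤ R) :
    γ * ∑ y, π.playProb v (fun _ => ω) y * (T - pulls b fun t => (y t).1) ≤ R := by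
  have hpulls (y : Fin T → Fin K × Z) : γ * (T - pulls b fun t => (y t).1)
      ≤ ∑ t, ∑ z, ω z * ((v (y t).1 z : ℝ) - v b z) := by
    rw [cast_pulls, show (T : ℝ) = ∑ _t : Fin T, 1 by simp, ← sum_sub_distrib, mul_sum]
    refine sum_le_sum fun t _ => ?_
    split_ifs with h
    · simp [h]
    · simpa using hγ _ h
  calc γ * ∑ y, π.playProb v (fun _ => ω) y * (T - pulls b fun t => (y t).1)
      = ∑ y, π.playProb v (fun _ => ω) y * (γ * (T - pulls b fun t => (y t).1)) := by
        rw [mul_sum]; exact sum_congr rfl fun _ _ => by ring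
    _ ≤ ∑ y, π.playProb v (fun _ => ω) y * ∑ t, ∑ z, ω z * ((v (y t).1 z : ℝ) - v b z) :=
        sum_le_sum fun y _ => mul_le_mul_of_nonneg_left (hpulls y)
          ((π.playProb_mem_stdSimplex v fun _ => hω).1 y)
    _ = ∑ y, π.playProb v (fun _ => ω) y * ∑ t, ((v (y t).1 (y t).2 : ℝ) - v b (y t).2) := by
        simp only [mul_sum (s := (univ : Finset (Fin T)))]
        rw [sum_comm, sum_comm (t := (univ : Finset (Fin T)))]
        exact sum_congr rfl fun t _ => (π.sum_playProb_mul_signal v (fun _ => hω) t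
          fun i z => (v i z : ℝ) - v b z).symm
    _ = ∑ z : Fin T → Z, (∏ t, ω (z t)) * ∑ a, π.actionProb (fun t i => v i (z t)) a *
          ∑ t, ((v (a t) (z t) : ℝ) - v b (z t)) :=
        π.sum_playProb_const v ω fun a z => ∑ t, ((v (a t) (z t) : ℝ) - v b (z t))
    _ ≤ ∑ z : Fin T → Z, (∏ t, ω (z t)) * R := by
        gcongr with z
        · exact (prod_mem_stdSimplex hω).1 z
        refine (sum_le_sum fun a _ => ?_).trans
          ((π.integral_actionLaw _ _).symm.trans_le (hR fun t i => v i (z t)))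
        exact mul_le_mul_of_nonneg_left (sum_sub_le_regret (fun t i => v i (z t)) a b)
          (π.actionProb_nonneg _ a)
    _ = R := by rw [← sum_mul, (prod_mem_stdSimplex hω).2, one_mul]

theorem exists_ne_sum_pulls_le (hK : 2 ≤ K) (hω : ω ∈ stdSimplex ℝ Z) {γ R : ℝ}
    (hγ : ∀ i ≠ b, γ ≤ ∑ z, ω z * (v i z - v b z))
    (hR : ∀ ℓ, ∫ a, regret ℓ a ∂(π.actionLaw ℓ) ≤ R) :
    ∃ i ≠ b, γ * ∑ y, π.playProb v (fun _ => ω) y * (pulls i fun t => (y t).1) ≤ R / (K - 1) := by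
  have hcard : (#(univ.erase b) : ℝ) = K - 1 := by
    rw [card_erase_of_mem (mem_univ b), card_univ, Fintype.card_fin, Nat.cast_pred (by omega)]
  have hpos : (0 : ℝ) < K - 1 := by
    have : (2 : ℝ) ≤ K := mod_cast hK
    linarith
  have hpulls (a : Fin T → Fin K) : ∑ i ∈ univ.erase b, (pulls i a : ℝ) = T - pulls b a := by
    rw [sum_erase_eq_sub (mem_univ b), ← Nat.cast_sum, sum_pulls]
  have hsum : ∑ i ∈ univ.erase b, γ * ∑ y, π.playProb v (fun _ => ω) y * (pulls i fun t => (y t).1)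
      ≤ ∑ i ∈ univ.erase b, R / ((K : ℝ) - 1) := by
    rw [sum_const, nsmul_eq_mul, hcard, mul_div_cancel₀ _ hpos.ne', ← mul_sum, sum_comm]
    simp only [← mul_sum, hpulls]
    exact π.mul_sum_playProb_le hω hγ hR
  obtain ⟨i, hi, hle⟩ := exists_le_of_sum_le
    (card_pos.1 (Nat.cast_pos.1 (hcard ▸ hpos))) hsum
  exact ⟨i, ne_of_mem_erase hi, hle⟩

theorem sum_playProb_pulls_le (hω : ω ∈ stdSimplex ℝ Z) {g : Z → ℝ} {c ε : ℝ} (hc : 0 < c)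
    (hg : ∀ z, g z ∈ Set.Icc 0 c) (hgv : ∀ z, ∀ i ≠ b, g z ≤ v i z - v b z) (hε : 0 ≤ ε) :
    ∑ y with 2 * pulls b (fun t => (y t).1) ≤ T, π.playProb v (fun _ => ω) y
      ≤ ∑ z : Fin T → Z, (∏ t, ω (z t)) * (π.actionLaw fun t i => v i (z t)).real
          {a | (∑ z, ω z * g z - c * (1 / 2 + ε)) * T ≤ regret (fun t i => v i (z t)) a}
        + Real.exp (-(2 * ε ^ 2 * T)) := by
  classical
  set μ := ∑ z, ω z * g z
  let ℓ (z : Fin T → Z) : Losses K T := fun t i => v i (z t)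
  have hind (a : Fin T → Fin K) (z : Fin T → Z) : (if 2 * pulls b a ≤ T then (1 : ℝ) else 0)
      ≤ (if (μ - c * (1 / 2 + ε)) * T ≤ regret (ℓ z) a then 1 else 0)
        + if ∑ t, g (z t) ≤ (μ - c * ε) * T then 1 else 0 := by
    have hreg := sum_sub_mul_pulls_le_regret (ℓ := ℓ z) (fun t => hgv (z t))
      (fun t => (hg (z t)).2) a
    split_ifs with hp hr hs hs <;> norm_num
    have hp' : c * (2 * pulls b a) ≤ c * T := by gcongr; exact_mod_cast hp
    linarith
  have hhoeffding := hoeffding_sum_le (ι := Fin T) hω hc hg hε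
  rw [Fintype.card_fin] at hhoeffding
  calc ∑ y with 2 * pulls b (fun t => (y t).1) ≤ T, π.playProb v (fun _ => ω) y
      = ∑ y, π.playProb v (fun _ => ω) y *
          if 2 * pulls b (fun t => (y t).1) ≤ T then 1 else 0 := by simp [sum_filter]
    _ = ∑ z : Fin T → Z, (∏ t, ω (z t)) * ∑ a, π.actionProb (ℓ z) a *
          if 2 * pulls b a ≤ T then 1 else 0 :=
        π.sum_playProb_const v ω fun a _ => if 2 * pulls b a ≤ T then 1 else 0
    _ ≤ ∑ z : Fin T → Z, (∏ t, ω (z t)) * ∑ a, π.actionProb (ℓ z) a *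
          ((if (μ - c * (1 / 2 + ε)) * T ≤ regret (ℓ z) a then 1 else 0)
            + if ∑ t, g (z t) ≤ (μ - c * ε) * T then 1 else 0) := by
        gcongr with z _ a
        exacts [(prod_mem_stdSimplex hω).1 z, π.actionProb_nonneg _ a, hind a z]
    _ = ∑ z : Fin T → Z, (∏ t, ω (z t)) * (π.actionLaw (ℓ z)).real
          {a | (μ - c * (1 / 2 + ε)) * T ≤ regret (ℓ z) a}
        + ∑ z : Fin T → Z with ∑ t, g (z t) ≤ (μ - c * ε) * T, ∏ t, ω (z t) := by
        simp only [real_actionLaw, mul_add (π.actionProb _ _), mul_add (Finset.prod _ _),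
          sum_add_distrib, ← sum_mul, (π.actionProb_mem_stdSimplex _).2, one_mul]
        simp only [sum_filter, mul_ite, mul_one, mul_zero]
    _ ≤ _ := by gcongr

theorem exists_le_real_actionLaw (hω : ω ∈ stdSimplex ℝ Z) {g : Z → ℝ} {c ε δ : ℝ} (hc : 0 < c)
    (hg : ∀ z, g z ∈ Set.Icc 0 c) (hgv : ∀ z, ∀ i ≠ b, g z ≤ v i z - v b z) (hε : 0 ≤ ε)
    (hδ : δ ≤ ∑ y with 2 * pulls b (fun t => (y t).1) ≤ T, π.playProb v (fun _ => ω) y) :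
    ∃ ℓ, δ - Real.exp (-(2 * ε ^ 2 * T)) ≤ (π.actionLaw ℓ).real
      {a | (∑ z, ω z * g z - c * (1 / 2 + ε)) * T ≤ regret ℓ a} := by
  obtain ⟨z, hz⟩ := exists_le_of_le_sum_mul (prod_mem_stdSimplex hω)
    (sub_le_iff_le_add.2 (hδ.trans (π.sum_playProb_pulls_le hω hc hg hgv hε)))
  exact ⟨fun t i => v i (z t), hz⟩

/-- The two-point argument: whichever of the arms `i` and `b` is the best one, the strategy can
hardly tell, so one of the two is neglected with a probability that is not too small. -/
theorem exp_neg_sum_pulls_mul_relEntropy_le (hib : i ≠ b) (v : Fin K → Z → unitInterval)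
    {p : Fin K → Z → ℝ} (hp : ∀ j, p j ∈ stdSimplex ℝ Z) {q : Z → ℝ} (hq : q ∈ stdSimplex ℝ Z)
    (hpq : ∀ z, q z = 0 → p i z = 0) :
    Real.exp (-((∑ y, π.playProb v p y * pulls i fun t => (y t).1) * relEntropy (p i) q)) / 2
      ≤ ∑ y with 2 * pulls b (fun t => (y t).1) ≤ T, π.playProb v p y
        + ∑ y with 2 * pulls i (fun t => (y t).1) ≤ T, π.playProb v (Function.update p i q) y := by
  have hp' (j : Fin K) : Function.update p i q j ∈ stdSimplex ℝ Z := by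
    rcases eq_or_ne j i with rfl | hj <;> simp [*]
  have hpp' (j : Fin K) (z : Z) (h : Function.update p i q j z = 0) : p j z = 0 := by
    rcases eq_or_ne j i with rfl | hj <;> simp_all
  have hdiv : relEntropy (π.playProb v p) (π.playProb v (Function.update p i q))
      = (∑ y, π.playProb v p y * pulls i fun t => (y t).1) * relEntropy (p i) q := by
    rw [π.relEntropy_playProb v hp hpp', sum_mul]
    refine sum_congr rfl fun y _ => ?_
    rw [mul_assoc, cast_pulls, sum_mul]
    refine congrArg _ (sum_congr rfl fun t _ => ?_)
    rcases eq_or_ne (y t).1 i with h | h <;> simp [h, relEntropy_self]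
  rw [← hdiv]
  refine (bretagnolle_huber (π.playProb_mem_stdSimplex v hp)
    (π.playProb_mem_stdSimplex v hp') (fun _ => π.playProb_eq_zero hpp')
    fun y => 2 * pulls b (fun t => (y t).1) ≤ T).trans (add_le_add_right ?_ _)
  refine sum_le_sum_of_subset_of_nonneg (fun y hy => ?_) fun y _ _ =>
    (π.playProb_mem_stdSimplex v hp').1 y
  simp only [mem_filter, mem_univ, true_and] at hy ⊢
  have := pulls_add_pulls_le hib fun t => (y t).1
  omega

end Strategy

end Regret

section ClippedNoise

variable {m : ℕ} {e h : ℝ}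

/-- The law of the noise common to all arms: weight `e` at the two ends of `0, …, m + 2` and `h` at
the other points. -/
def noiseWeight (m : ℕ) (e h : ℝ) (k : Fin (m + 3)) : ℝ :=
  if k = 0 ∨ k = Fin.last (m + 2) then e else h

/-- The noise shifted down by `s` and clipped to `0, …, m`; the truncated subtraction clips
at `0`. The larger `s`, the better the arm. -/
def level (s : Fin 3) (k : Fin (m + 3)) : Fin (m + 1) :=
  ⟨min (k - s) m, by omega⟩

/-- The law of `level s` when the noise has the law `noiseWeight`: the shift only moves mass `h`
between the two ends. -/
def levelLaw (m : ℕ) (e h : ℝ) (s : Fin 3) (x : Fin (m + 1)) : ℝ :=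
  h + (if x = 0 then e + (s - 1) * h else 0) + if x = Fin.last m then e + (1 - s) * h else 0

/-- The grid point `x / m` of the unit interval. -/
noncomputable def gridPoint (x : Fin (m + 1)) : unitInterval :=
  ⟨x / m, by positivity, div_le_one_of_le₀ (mod_cast Nat.lt_succ_iff.1 x.isLt) (by positivity)⟩

theorem sum_noiseWeight_mul (G : Fin (m + 3) → ℝ) :
    ∑ k, noiseWeight m e h k * G k
      = e * G 0 + h * ∑ j : Fin (m + 1), G j.castSucc.succ + e * G (Fin.last (m + 2)) := by
  have hmid (j : Fin (m + 1)) : noiseWeight m e h j.castSucc.succ = h :=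
    if_neg (by simp only [Fin.ext_iff, Fin.val_castSucc, Fin.val_succ, Fin.val_zero, Fin.val_last]
               omega)
  rw [Fin.sum_univ_succ, Fin.sum_univ_castSucc, mul_sum, ← add_assoc]
  simp only [hmid]
  simp [noiseWeight]

theorem noiseWeight_mem_stdSimplex (he : 0 ≤ e) (hh : 0 ≤ h) (hsum : 2 * e + (m + 1) * h = 1) :
    noiseWeight m e h ∈ stdSimplex ℝ (Fin (m + 3)) := by
  refine ⟨fun k => ?_, ?_⟩
  · unfold noiseWeight
    split_ifs <;> assumption
  · have h1 := sum_noiseWeight_mul (e := e) (h := h) fun _ : Fin (m + 3) => 1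
    simp only [mul_one, sum_const, card_univ, Fintype.card_fin, nsmul_eq_mul, Nat.cast_add,
      Nat.cast_one] at h1
    linarith

theorem sum_levelLaw_mul (s : Fin 3) (G : Fin (m + 1) → ℝ) :
    ∑ x, levelLaw m e h s x * G x
      = h * ∑ x, G x + (e + (s - 1) * h) * G 0 + (e + (1 - s) * h) * G (Fin.last m) := by
  simp [levelLaw, add_mul, sum_add_distrib, ← mul_sum, ite_mul]

theorem sum_level_eq (s : Fin 3) (G : Fin (m + 1) → ℝ) :
    ∑ j : Fin (m + 1), G (level s j.castSucc.succ)
      = ∑ x, G x + (s - 1) * G 0 + (1 - s) * G (Fin.last m) := by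
  fin_cases s
  · have h1 (j : Fin m) : level 0 j.castSucc.castSucc.succ = j.succ := by
      simp [level, Fin.ext_iff]
    have h2 : level 0 (Fin.last m).castSucc.succ = Fin.last m := by simp [level, Fin.ext_iff]
    simp only [Fin.zero_eta, Fin.sum_univ_castSucc (fun j => G (level 0 j.castSucc.succ)), h1, h2,
      Fin.sum_univ_succ G]
    simp
  · have h1 (j : Fin (m + 1)) : level 1 j.castSucc.succ = j := by
      simp [level, Fin.ext_iff]; omega
    simp only [Fin.mk_one, h1]
    simp
  · have h1 (j : Fin m) : level 2 j.succ.castSucc.succ = j.castSucc := by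
      simp [level, Fin.ext_iff]
    have h2 : level 2 (0 : Fin (m + 1)).castSucc.succ = 0 := by simp [level]
    simp only [Fin.reduceFinMk, Fin.sum_univ_succ (fun j => G (level 2 j.castSucc.succ)), h1, h2,
      Fin.sum_univ_castSucc G]
    norm_num
    ring

theorem sum_noiseWeight_mul_level (s : Fin 3) (G : Fin (m + 1) → ℝ) :
    ∑ k, noiseWeight m e h k * G (level s k) = ∑ x, levelLaw m e h s x * G x := by
  have hfirst : level s (0 : Fin (m + 3)) = 0 := by simp [level]
  have hlast : level s (Fin.last (m + 2)) = Fin.last m := by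
    simp only [level, Fin.val_last, Fin.ext_iff]
    omega
  rw [sum_noiseWeight_mul fun k => G (level s k), hfirst, hlast, sum_level_eq, sum_levelLaw_mul]
  ring

theorem levelLaw_pos (he : 0 < e) (hh : 0 < h) (s : Fin 3) (x : Fin (m + 1)) :
    0 < levelLaw m e h s x := by
  have hs : (s : ℝ) ≤ 2 := mod_cast (by omega : (s : ℕ) ≤ 2)
  unfold levelLaw
  have : 0 ≤ s * h := by positivity
  have : s * h ≤ 2 * h := by gcongr
  split_ifs <;> linarith

theorem levelLaw_mem_stdSimplex (he : 0 < e) (hh : 0 < h) (hsum : 2 * e + (m + 1) * h = 1)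
    (s : Fin 3) : levelLaw m e h s ∈ stdSimplex ℝ (Fin (m + 1)) := by
  refine ⟨fun x => (levelLaw_pos he hh s x).le, ?_⟩
  have h1 := sum_noiseWeight_mul_level (m := m) (e := e) (h := h) s fun _ => 1
  simpa only [mul_one, (noiseWeight_mem_stdSimplex he.le hh.le hsum).2] using h1.symm

theorem relEntropy_levelLaw (hh : h ≠ 0) (hm : m ≠ 0) :
    relEntropy (levelLaw m e h 0) (levelLaw m e h 2) = 2 * h * Real.log ((e + 2 * h) / e) := by
  have hne : (0 : Fin (m + 1)) ≠ Fin.last m := by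
    simpa [Fin.ext_iff] using hm.symm
  have hratio (x : Fin (m + 1)) : Real.log (levelLaw m e h 0 x / levelLaw m e h 2 x)
      = (if x = 0 then -Real.log ((e + 2 * h) / e) else 0)
        + if x = Fin.last m then Real.log ((e + 2 * h) / e) else 0 := by
    rcases eq_or_ne x 0 with rfl | h0
    · rw [← Real.log_inv, inv_div]
      simp only [levelLaw, hne, if_true, if_false]
      norm_num
      ring_nf
    rcases eq_or_ne x (Fin.last m) with rfl | hl
    · simp only [levelLaw, hne.symm, if_true, if_false]
      norm_num
      ring_nf
    · simp [levelLaw, h0, hl, hh]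
  simp only [relEntropy, hratio, sum_levelLaw_mul, sum_add_distrib, sum_ite_eq', mem_univ, if_true,
    hne, hne.symm, if_false]
  norm_num
  ring

/-- Splitting the logarithm at `e + h` gains a second order term over `log (1 + x) ≤ x`. -/
theorem relEntropy_levelLaw_le (he : 0 < e) (hh : 0 < h) (hm : m ≠ 0) :
    relEntropy (levelLaw m e h 0) (levelLaw m e h 2) ≤ 2 * h * (h / e + h / (e + h)) := by
  have hsplit : (e + 2 * h) / e = (e + h) / e * ((e + 2 * h) / (e + h)) := by field_simp
  rw [relEntropy_levelLaw hh.ne' hm, hsplit, Real.log_mul (by positivity) (by positivity)]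
  gcongr
  · exact (Real.log_le_sub_one_of_pos (by positivity)).trans_eq (by field_simp; ring)
  · exact (Real.log_le_sub_one_of_pos (by positivity)).trans_eq (by field_simp; ring)

theorem gridPoint_level_antitone (k : Fin (m + 3)) :
    Antitone fun s => (gridPoint (level s k) : ℝ) := fun s s' hs => by
  simp only [gridPoint, level]
  gcongr
  omega

theorem gridPoint_level_sub_mem_Icc (s : Fin 2) (k : Fin (m + 3)) :
    (gridPoint (level s.castSucc k) : ℝ) - gridPoint (level s.succ k)
      ∈ Set.Icc 0 (1 / (m : ℝ)) := by
  refine ⟨sub_nonneg.2 (gridPoint_level_antitone k s.castSucc_lt_succ.le), ?_⟩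
  have hlevel : (level s.castSucc k : ℕ) ≤ level s.succ k + 1 := by
    simp only [level, Fin.val_castSucc, Fin.val_succ]
    omega
  rw [gridPoint, gridPoint, ← sub_div]
  gcongr
  rw [sub_le_iff_le_add']
  exact_mod_cast hlevel

theorem sum_noiseWeight_mul_gridPoint_sub (hm : m ≠ 0) (s : Fin 2) :
    ∑ k, noiseWeight m e h k *
      ((gridPoint (level s.castSucc k) : ℝ) - gridPoint (level s.succ k)) = h := by
  simp only [mul_sub, sum_sub_distrib]
  rw [sum_noiseWeight_mul_level _ fun x => (gridPoint x : ℝ),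
    sum_noiseWeight_mul_level _ fun x => (gridPoint x : ℝ)]
  simp [sum_levelLaw_mul, gridPoint, hm]
  ring

end ClippedNoise

namespace Strategy

variable {K T m : ℕ} (π : Strategy K T) {e h : ℝ} {σ : Fin K → Fin 3} {b : Fin K}

theorem exists_ne_sum_pulls_levelLaw_le (hK : 2 ≤ K) (hm : m ≠ 0) (he : 0 ≤ e) (hh : 0 ≤ h)
    (hsum : 2 * e + (m + 1) * h = 1) {s : Fin 2} (hb : σ b = s.succ)
    (hσ : ∀ i ≠ b, σ i = s.castSucc) {R : ℝ}
    (hR : ∀ ℓ, ∫ a, regret ℓ a ∂(π.actionLaw ℓ) ≤ R) :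
    ∃ i ≠ b, h * ∑ y, π.playProb (fun _ => gridPoint) (fun j => levelLaw m e h (σ j)) y *
      (pulls i fun t => (y t).1) ≤ R / (K - 1) := by
  obtain ⟨i, hi, hle⟩ := π.exists_ne_sum_pulls_le (b := b)
    (v := fun j k => gridPoint (level (σ j) k)) hK (noiseWeight_mem_stdSimplex he hh hsum)
    (fun i hi => by rw [hb, hσ i hi, sum_noiseWeight_mul_gridPoint_sub hm s]) hR
  rw [π.sum_playProb_map_signal _ (fun j => sum_noiseWeight_mul_level (σ j))
    fun a => (pulls i a : ℝ)] at hle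
  exact ⟨i, hi, hle⟩

theorem exists_le_real_actionLaw_of_levelLaw (hm : m ≠ 0) (he : 0 ≤ e) (hh : 0 ≤ h)
    (hsum : 2 * e + (m + 1) * h = 1) {s : Fin 2} (hb : σ b = s.succ)
    (hσ : ∀ i ≠ b, σ i ≤ s.castSucc) {ε δ : ℝ} (hε : 0 ≤ ε)
    (hδ : δ ≤ ∑ y with 2 * pulls b (fun t => (y t).1) ≤ T,
      π.playProb (fun _ => gridPoint) (fun i => levelLaw m e h (σ i)) y) :
    ∃ ℓ, δ - Real.exp (-(2 * ε ^ 2 * T)) ≤ (π.actionLaw ℓ).real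
      {a | (h - 1 / m * (1 / 2 + ε)) * T ≤ regret ℓ a} := by
  have hmap := π.sum_playProb_map_signal (fun _ => gridPoint)
    (fun i => sum_noiseWeight_mul_level (m := m) (e := e) (h := h) (σ i))
    fun a => if 2 * pulls b a ≤ T then 1 else 0
  simp only [mul_ite, mul_one, mul_zero, ← sum_filter] at hmap
  rw [← sum_noiseWeight_mul_gridPoint_sub (e := e) (h := h) hm s]
  refine π.exists_le_real_actionLaw (b := b) (v := fun i k => gridPoint (level (σ i) k))
    (noiseWeight_mem_stdSimplex he hh hsum) (by positivity) (gridPoint_level_sub_mem_Icc s)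
    (fun k i hi => ?_) hε (hδ.trans_eq hmap.symm)
  rw [hb]
  exact sub_le_sub_right (gridPoint_level_antitone k (hσ i hi)) _

theorem two_mul_le_sum_playProb_levelLaw_add (hm : m ≠ 0) (he : 0 < e) (hh : 0 < h)
    (hsum : 2 * e + (m + 1) * h = 1) {i : Fin K} (hib : i ≠ b) (hσi : σ i = 0) {ρ δ : ℝ}
    (hδ : 0 < δ)
    (hpulls : h * ∑ y, π.playProb (fun _ => gridPoint) (fun j => levelLaw m e h (σ j)) y *
      (pulls i fun t => (y t).1) ≤ ρ)
    (hρδ : ρ * (2 * (h / e + h / (e + h))) ≤ Real.log (1 / (4 * δ))) :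
    2 * δ ≤ ∑ y with 2 * pulls b (fun t => (y t).1) ≤ T,
        π.playProb (fun _ => gridPoint) (fun j => levelLaw m e h (σ j)) y
      + ∑ y with 2 * pulls i (fun t => (y t).1) ≤ T,
        π.playProb (fun _ => gridPoint) (fun j => levelLaw m e h (Function.update σ i 2 j)) y := by
  have hbh := π.exp_neg_sum_pulls_mul_relEntropy_le hib (fun _ => gridPoint)
    (p := fun j => levelLaw m e h (σ j)) (fun j => levelLaw_mem_stdSimplex he hh hsum (σ j))
    (levelLaw_mem_stdSimplex he hh hsum 2) fun x hx => absurd hx (levelLaw_pos he hh 2 x).ne'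
  have hupdate : Function.update (fun j => levelLaw m e h (σ j)) i (levelLaw m e h 2)
      = fun j => levelLaw m e h (Function.update σ i 2 j) :=
    (Function.comp_update (levelLaw m e h) σ i 2).symm
  rw [hupdate] at hbh
  refine le_trans ?_ hbh
  set E := ∑ y, π.playProb (fun _ => gridPoint) (fun j => levelLaw m e h (σ j)) y *
    (pulls i fun t => (y t).1)
  have hE0 : 0 ≤ E := sum_nonneg fun y _ => mul_nonneg ((π.playProb_mem_stdSimplex _
    fun j => levelLaw_mem_stdSimplex he hh hsum (σ j)).1 y) (Nat.cast_nonneg _)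
  have hE : E * relEntropy (levelLaw m e h (σ i)) (levelLaw m e h 2) ≤ Real.log (1 / (4 * δ)) :=
    calc E * relEntropy (levelLaw m e h (σ i)) (levelLaw m e h 2)
        ≤ E * (2 * h * (h / e + h / (e + h))) := by
          rw [hσi]
          exact mul_le_mul_of_nonneg_left (relEntropy_levelLaw_le he hh hm) hE0
      _ = h * E * (2 * (h / e + h / (e + h))) := by ring
      _ ≤ ρ * (2 * (h / e + h / (e + h))) := by gcongr
      _ ≤ Real.log (1 / (4 * δ)) := hρδ
  have hexp := Real.exp_le_exp.2 (neg_le_neg hE)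
  rw [← Real.log_inv, Real.exp_log (by positivity), one_div, inv_inv] at hexp
  linarith

theorem exists_le_real_actionLaw_of_mul_le_log (hK : 2 ≤ K) (hm : m ≠ 0) (he : 0 < e)
    (hh : 0 < h) (hsum : 2 * e + (m + 1) * h = 1) {R δ ε : ℝ}
    (hR : ∀ ℓ, ∫ a, regret ℓ a ∂(π.actionLaw ℓ) ≤ R) (hδ : 0 < δ) (hε : 0 ≤ ε)
    (hRδ : R / (K - 1) * (2 * (h / e + h / (e + h))) ≤ Real.log (1 / (4 * δ))) :
    ∃ ℓ, δ - Real.exp (-(2 * ε ^ 2 * T)) ≤ (π.actionLaw ℓ).real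
      {a | (h - 1 / m * (1 / 2 + ε)) * T ≤ regret ℓ a} := by
  let b : Fin K := ⟨0, by omega⟩
  let σ : Fin K → Fin 3 := Pi.single b 1
  have hσb : σ b = Fin.succ (0 : Fin 2) := Pi.single_eq_same b 1
  have hσ (j : Fin K) (hj : j ≠ b) : σ j = Fin.castSucc (0 : Fin 2) := Pi.single_eq_of_ne hj 1
  obtain ⟨i, hib, hpulls⟩ := π.exists_ne_sum_pulls_levelLaw_le hK hm he.le hh.le hsum hσb hσ hR
  have hδ2 := π.two_mul_le_sum_playProb_levelLaw_add hm he hh hsum hib (hσ i hib) hδ hpulls hRδ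
  rcases le_or_gt δ (∑ y with 2 * pulls b (fun t => (y t).1) ≤ T,
    π.playProb (fun _ => gridPoint) (fun j => levelLaw m e h (σ j)) y) with hb | hb
  · exact π.exists_le_real_actionLaw_of_levelLaw hm he.le hh.le hsum hσb
      (fun j hj => (hσ j hj).le) hε hb
  · refine π.exists_le_real_actionLaw_of_levelLaw (σ := Function.update σ i 2) (b := i) (s := 1)
      hm he.le hh.le hsum (Function.update_self ..) (fun j hj => ?_) hε (by linarith)
    rw [Function.update_of_ne hj]
    rcases eq_or_ne j b with rfl | hjb
    · exact hσb.le
    · rw [hσ j hjb]; decide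

theorem exists_le_real_actionLaw_of_le_mul_log (hK : 2 ≤ K) (hm : 17 ≤ m) {R δ : ℝ}
    (hR : ∀ ℓ, ∫ a, regret ℓ a ∂(π.actionLaw ℓ) ≤ R) (hR0 : 0 ≤ R) (hδ : 0 < δ)
    (hRδ : 34 * (R / (K - 1)) ≤ m * Real.log (1 / (4 * δ))) :
    ∃ ℓ, δ - Real.exp (-(T / 32)) ≤ (π.actionLaw ℓ).real {a | 7 / 40 * (T / m) ≤ regret ℓ a} := by
  have hm' : (17 : ℝ) ≤ m := mod_cast hm
  have hK' : (0 : ℝ) < K - 1 := sub_pos.2 (mod_cast hK)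
  have h4 : (0 : ℝ) < m - 4 := by linarith
  -- The expected gap `h` has to exceed `(1 / 2 + 1 / 8) / m`, with `1 / 8` for the deviation of the
  -- noise from its mean; then `2 * e + (m + 1) * h = 1` fixes `e`.
  let e : ℝ := (m - 4) / (10 * m)
  let h : ℝ := 4 / (5 * m)
  have he : 0 < e := by positivity
  have hh : 0 < h := by positivity
  have hsum : 2 * e + (m + 1) * h = 1 := by
    simp only [e, h]
    field_simp
    ring
  have hadd : e + h = (m + 4) / (10 * m) := by
    simp only [e, h]
    field_simp
    ring
  have hratio : 2 * (h / e + h / (e + h)) ≤ 34 / m := by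
    have heq : 2 * (h / e + h / (e + h)) = 32 * m / ((m - 4) * (m + 4)) := by
      rw [hadd]
      simp only [e, h]
      field_simp
      ring
    rw [heq, div_le_div_iff₀ (by positivity) (by positivity)]
    nlinarith
  have hlog : R / (K - 1) * (2 * (h / e + h / (e + h))) ≤ Real.log (1 / (4 * δ)) := by
    calc R / (K - 1) * (2 * (h / e + h / (e + h))) ≤ R / (K - 1) * (34 / m) := by gcongr
      _ = 34 * (R / (K - 1)) / m := by ring
      _ ≤ Real.log (1 / (4 * δ)) := (div_le_iff₀' (by positivity)).2 hRδ
  have hexp : 2 * (1 / 8 : ℝ) ^ 2 * T = T / 32 := by ring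
  have hgap : (h - 1 / m * (1 / 2 + 1 / 8)) * T = 7 / 40 * (T / m) := by
    simp only [h]
    ring
  simpa only [hexp, hgap] using π.exists_le_real_actionLaw_of_mul_le_log (ε := 1 / 8) hK
    (by omega) he hh hsum hR hδ (by norm_num) hlog

end Strategy

theorem exists_nat_mul_mem_Icc {x y : ℝ} (hx : 0 < x) (hxy : x ≤ y) :
    ∃ m : ℕ, 17 ≤ m ∧ (m * x : ℝ) ∈ Set.Icc (34 * y) (35 * y) := by
  have hfloor : 35 * (y / x) < ⌊35 * (y / x)⌋₊ + 1 := Nat.lt_floor_add_one _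
  have hone : 1 ≤ y / x := (one_le_div hx).2 hxy
  have hm : 34 * (y / x) ≤ ⌊35 * (y / x)⌋₊ := by linarith
  refine ⟨⌊35 * (y / x)⌋₊, Nat.le_floor (by push_cast; linarith), ?_, ?_⟩
  · rwa [← div_le_iff₀ hx, mul_div_assoc]
  · rw [← le_div_iff₀ hx, mul_div_assoc]
    exact Nat.floor_le (by positivity)

theorem exp_neg_div_le_half {c δ t : ℝ} (hc : 0 < c) (hδ : 0 < δ)
    (ht : c * Real.log (2 / δ) ≤ t) : Real.exp (-(t / c)) ≤ δ / 2 := by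
  rw [Real.exp_neg, ← inv_div 2 δ]
  gcongr
  rwa [← Real.log_le_iff_le_exp (by positivity), le_div_iff₀' hc]

namespace Strategy

theorem exists_le_real_actionLaw_of_log_le {K T : ℕ} (π : Strategy K T) (hK : 2 ≤ K) {R δ : ℝ}
    (hR : ∀ ℓ, ∫ a, regret ℓ a ∂(π.actionLaw ℓ) ≤ R) (hδ : δ ∈ Set.Ioo (0 : ℝ) (1 / 4))
    (hδR : Real.log (1 / (4 * δ)) ≤ R / (K - 1)) :
    ∃ ℓ, δ - Real.exp (-(T / 32)) ≤ (π.actionLaw ℓ).real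
      {a | (K - 1) * T * Real.log (1 / (4 * δ)) / (200 * R) ≤ regret ℓ a} := by
  obtain ⟨hδ0, hδ4⟩ := hδ
  have hL : 0 < Real.log (1 / (4 * δ)) :=
    Real.log_pos ((one_lt_div (by positivity)).2 (by linarith))
  have hK' : (0 : ℝ) < K - 1 := sub_pos.2 (mod_cast hK)
  have hR0 : 0 < R := (div_pos_iff_of_pos_right hK').1 (hL.trans_le hδR)
  obtain ⟨m, h17, hm, hm'⟩ := exists_nat_mul_mem_Icc hL hδR
  obtain ⟨ℓ, hℓ⟩ := π.exists_le_real_actionLaw_of_le_mul_log hK h17 hR hR0.le hδ0 hm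
  have hgap : (K - 1) * T * Real.log (1 / (4 * δ)) / (200 * R) ≤ 7 / 40 * (T / m) := by
    have hm0 : (0 : ℝ) < m := mod_cast (by omega : 0 < m)
    rw [mul_div_assoc', div_le_div_iff₀ (by positivity) hm0]
    calc (K - 1) * T * Real.log (1 / (4 * δ)) * m
        = (K - 1) * T * (m * Real.log (1 / (4 * δ))) := by ring
      _ ≤ (K - 1) * T * (35 * (R / (K - 1))) := by gcongr
      _ = 7 / 40 * T * (200 * R) := by field_simp; ring
  exact ⟨ℓ, hℓ.trans (measureReal_mono fun a (ha : 7 / 40 * (T / m : ℝ) ≤ _) => hgap.trans ha)⟩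

end Strategy

end Bandit

theorem theorem2 {K T : ℕ} (hK : 2 ≤ K) (hT : 1 ≤ T) (π : Bandit.Strategy K T)
    {C : ℝ} (hC : 0 < C)
    (hπ : ∀ ℓ : Bandit.Losses K T,
      ∫ a, Bandit.regret ℓ a ∂(π.actionLaw ℓ) ≤ C * Real.sqrt (((K : ℝ) - 1) * T))
    {δ : ℝ} (hδ : δ ∈ Set.Ioo (0 : ℝ) (1 / 4))
    (hδC : Real.sqrt (((K : ℝ) - 1) / T) * Real.log (1 / (4 * δ)) ≤ C)
    (hδT : 32 * Real.log (2 / δ) ≤ (T : ℝ)) :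
    ∃ ℓ : Bandit.Losses K T,
      δ / 2 ≤ (π.actionLaw ℓ).real
        {a | Real.sqrt (((K : ℝ) - 1) * T) * Real.log (1 / (4 * δ)) / (203 * C)
          ≤ Bandit.regret ℓ a} := by
  have hK' : (0 : ℝ) < K - 1 := sub_pos.2 (mod_cast hK)
  have : (0 : ℝ) < T := mod_cast hT
  have hL : 0 < Real.log (1 / (4 * δ)) :=
    Real.log_pos ((one_lt_div (by linarith [hδ.1])).2 (by linarith [hδ.2]))
  have hδ0 : 0 < δ := hδ.1
  set s := √(((K : ℝ) - 1) * T)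
  have hs0 : 0 < s := by positivity
  have hs2 : s ^ 2 = (K - 1) * T := Real.sq_sqrt (by positivity)
  have hsqrt : √(((K : ℝ) - 1) / T) = (K - 1) / s := by
    rw [Real.sqrt_eq_iff_mul_self_eq (by positivity) (by positivity)]
    field_simp
    exact hs2
  obtain ⟨ℓ, hℓ⟩ := π.exists_le_real_actionLaw_of_log_le hK hπ hδ <| by
    rwa [hsqrt, div_mul_eq_mul_div, div_le_iff₀ hs0, ← le_div_iff₀' hK'] at hδC
  have hexp := Bandit.exp_neg_div_le_half (by norm_num) hδ0 hδT
  have hgap : s * Real.log (1 / (4 * δ)) / (203 * C)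
      ≤ (K - 1) * T * Real.log (1 / (4 * δ)) / (200 * (C * s)) :=
    calc s * Real.log (1 / (4 * δ)) / (203 * C)
        ≤ s * Real.log (1 / (4 * δ)) / (200 * C) := by gcongr; norm_num
      _ = _ := by rw [← hs2]; field_simp
  exact ⟨ℓ, le_trans (by linarith) (hℓ.trans (measureReal_mono fun a ha => hgap.trans ha))⟩
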